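/- Let $p>5$ be a prime and let $\Gamma_p:\mathbb{Z}_p\to\mathbb{Z}_p$ be Morita's $p$-adic Gamma function, i.e. the continuous extension to $\mathbb{Z}_p$ of the sequence $$n\mapsto(-1)^n\prod_{\substack{0\le k<n\\ \gcd(k,p)=1}}k\qquad(n\in\mathbb{N}).$$ For $a,b\in\mathbb{Q}_p$ write $a\equiv b\pmod{p^2}$ when $a-b\in p^2\mathbb{Z}_p$. Then $$\sum_{k=0}^{(p-1)/2}\frac{k^3\binom{2k}{k}^3}{64^k}\equiv \begin{cases}0\pmod{p^2}&\text{if }p\equiv 1\pmod 4,\\[2mm] -\dfrac{2}{5\,\Gamma_p\!\left(\frac14\right)^4}\pmod{p^2}&\text{if }p\equiv 3\pmod 4.\end{cases}$$ -/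

import Mathlib

open Filter Topology

/-- The sequence `n ↦ (-1)^n ∏_{0 ≤ k < n, (k, p) = 1} k`, viewed in the `p`-adic integers. -/
noncomputable def moritaSeq (p : ℕ) [Fact p.Prime] (n : ℕ) : ℤ_[p] :=
  (-1) ^ n * ∏ k ∈ Finset.range n with k.Coprime p, (k : ℤ_[p])

/-- Morita's `p`-adic Gamma function: the extension by continuity of `moritaSeq p` from `ℕ` to
`ℤ_[p]`; its value at `x` is the limit of `moritaSeq p n` as the natural number `n` tends
`p`-adically to `x`.  For odd `p` the limits exist, and the function is the unique continuous
one extending the sequence (`moritaGamma_natCast`, `continuous_moritaGamma`,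
`moritaGamma_unique`). -/
noncomputable def moritaGamma (p : ℕ) [Fact p.Prime] (x : ℤ_[p]) : ℤ_[p] :=
  limUnder (comap (Nat.cast : ℕ → ℤ_[p]) (𝓝 x)) (moritaSeq p)

/-- Congruence `a ≡ b (mod m)` of `p`-adic numbers: `a - b ∈ m ℤ_p`. -/
def PadicModEq (p : ℕ) [Fact p.Prime] (m : ℕ) (a b : ℚ_[p]) : Prop :=
  ∃ z : ℤ_[p], a - b = (m : ℚ_[p]) * (z : ℚ_[p])

theorem prod_units_zmod_prime_pow {p : ℕ} (hp : p.Prime) (hp2 : p ≠ 2) {v : ℕ} (hv : v ≠ 0) :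
    haveI : NeZero (p ^ v) := ⟨pow_ne_zero v hp.ne_zero⟩
    ∏ u : (ZMod (p ^ v))ˣ, u = -1 := by
  have : NeZero (p ^ v) := ⟨pow_ne_zero v hp.ne_zero⟩
  have h2 : 2 < p ^ v := lt_of_lt_of_le (lt_of_le_of_ne hp.two_le (Ne.symm hp2))
    (Nat.le_self_pow hv p)
  have : Fact (2 < p ^ v) := ⟨h2⟩
  have : Fact (1 < p ^ v) := ⟨by omega⟩
  have hne : (-1 : (ZMod (p ^ v))ˣ) ≠ 1 := by
    intro h
    exact ZMod.neg_one_ne_one (congrArg Units.val h)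
  have hsq : ∀ u : (ZMod (p ^ v))ˣ, u * u = 1 → u = 1 ∨ u = -1 := by
    intro u hu
    have hcyc : IsCyclic (ZMod (p ^ v))ˣ := ZMod.isCyclic_units_of_prime_pow p hp hp2 v
    by_contra hcon
    push Not at hcon
    have hcard := IsCyclic.card_pow_eq_one_le (α := (ZMod (p ^ v))ˣ) (n := 2) (by norm_num)
    have hsub : ({1, -1, u} : Finset (ZMod (p ^ v))ˣ) ⊆
        Finset.univ.filter (fun a => a ^ 2 = 1) := by
      intro a ha
      simp only [Finset.mem_insert, Finset.mem_singleton] at ha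
      rcases ha with rfl | rfl | rfl <;> simp [sq, hu]
    have h3 : ({1, -1, u} : Finset (ZMod (p ^ v))ˣ).card = 3 := by
      rw [Finset.card_eq_three]
      exact ⟨1, -1, u, hne.symm, hcon.1.symm, hcon.2.symm, rfl⟩
    have := Finset.card_le_card hsub
    omega
  have key : ∏ u ∈ (Finset.univ.erase (-1 : (ZMod (p ^ v))ˣ)), u = 1 := by
    refine Finset.prod_involution (fun x _ => x⁻¹) (by simp) ?_ ?_ (by simp)
    · intro a ha ha1 h
      have : a * a = 1 := by
        nth_rewrite 2 [← h]
        simp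
      rcases hsq a this with h | h
      · exact ha1 h
      · exact (Finset.ne_of_mem_erase ha) h
    · intro a ha
      refine Finset.mem_erase.2 ⟨fun h => Finset.ne_of_mem_erase ha ?_, Finset.mem_univ _⟩
      rw [← inv_inv a, h]
      simp
  rw [← Finset.mul_prod_erase _ _ (Finset.mem_univ (-1 : (ZMod (p ^ v))ˣ)), key, mul_one]

theorem prod_range_coprime_zmod {p : ℕ} (hp : p.Prime) (hp2 : p ≠ 2) {v : ℕ} (hv : v ≠ 0) :
    ∏ k ∈ Finset.range (p ^ v) with k.Coprime p, (k : ZMod (p ^ v)) = -1 := by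
  have : NeZero (p ^ v) := ⟨pow_ne_zero v hp.ne_zero⟩
  have h := congrArg Units.val (prod_units_zmod_prime_pow hp hp2 hv)
  rw [← Units.coeHom_apply, map_prod] at h
  simp only [Units.coeHom_apply, Units.val_neg, Units.val_one] at h
  rw [← h]
  symm
  refine Finset.prod_bij (fun u _ => (u : ZMod (p ^ v)).val) ?_ ?_ ?_ ?_
  · intro u _
    refine Finset.mem_filter.2 ⟨Finset.mem_range.2 (ZMod.val_lt _), ?_⟩
    exact (Nat.coprime_pow_right_iff (Nat.pos_of_ne_zero hv) _ _).1 (ZMod.val_coe_unit_coprime u)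
  · intro a _ b _ hab
    exact Units.ext (ZMod.val_injective _ hab)
  · intro k hk
    obtain ⟨hk1, hk2⟩ := Finset.mem_filter.1 hk
    refine ⟨ZMod.unitOfCoprime k (hk2.pow_right v), Finset.mem_univ _, ?_⟩
    rw [ZMod.coe_unitOfCoprime, ZMod.val_natCast, Nat.mod_eq_of_lt (Finset.mem_range.1 hk1)]
  · intro u _
    simp

theorem moritaSeq_succ (p : ℕ) [Fact p.Prime] (n : ℕ) :
    moritaSeq p (n + 1) = -(if n.Coprime p then (n : ℤ_[p]) else 1) * moritaSeq p n := by
  unfold moritaSeq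
  rw [Finset.range_add_one, Finset.filter_insert]
  split_ifs with h
  · rw [Finset.prod_insert (by simp)]
    ring
  · ring

theorem toZModPow_moritaSeq_add {p : ℕ} [hp : Fact p.Prime] (hp2 : p ≠ 2) {v : ℕ} (hv : v ≠ 0)
    (n : ℕ) : PadicInt.toZModPow v (moritaSeq p (n + p ^ v)) =
      PadicInt.toZModPow v (moritaSeq p n) := by
  induction n with
  | zero =>
    have hodd : Odd (p ^ v) := (hp.out.odd_of_ne_two hp2).pow
    have := prod_range_coprime_zmod hp.out hp2 hv
    simp [moritaSeq, hodd.neg_one_pow, this]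
  | succ n ih =>
    rw [add_right_comm, moritaSeq_succ, moritaSeq_succ, map_mul, map_mul, ih]
    have hc : (n + p ^ v).Coprime p ↔ n.Coprime p := by
      obtain ⟨w, rfl⟩ := Nat.exists_eq_succ_of_ne_zero hv
      rw [pow_succ]
      exact Nat.coprime_add_mul_right_left n p (p ^ w)
    congr 1
    by_cases h : n.Coprime p
    · rw [if_pos h, if_pos (hc.2 h)]
      simp only [map_neg, map_natCast]
      rw [Nat.cast_add, ZMod.natCast_self, add_zero]
    · rw [if_neg h, if_neg (fun h' => h (hc.1 h'))]

theorem toZModPow_moritaSeq_congr {p : ℕ} [hp : Fact p.Prime] (hp2 : p ≠ 2) {v : ℕ} (hv : v ≠ 0)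
    {m n : ℕ} (h : m ≡ n [MOD p ^ v]) : PadicInt.toZModPow v (moritaSeq p m) =
      PadicInt.toZModPow v (moritaSeq p n) := by
  have key : ∀ a b : ℕ, PadicInt.toZModPow v (moritaSeq p (a + p ^ v * b)) =
      PadicInt.toZModPow v (moritaSeq p a) := by
    intro a b
    induction b with
    | zero => simp
    | succ b ih => rw [mul_add, mul_one, ← add_assoc, toZModPow_moritaSeq_add hp2 hv, ih]
  rw [← Nat.mod_add_div m (p ^ v), ← Nat.mod_add_div n (p ^ v), key, key, h]

theorem dist_le_iff_toZModPow {p : ℕ} [Fact p.Prime] (v : ℕ) (x y : ℤ_[p]) :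
    dist x y ≤ (p : ℝ) ^ (-(v : ℤ)) ↔ PadicInt.toZModPow v x = PadicInt.toZModPow v y := by
  rw [dist_eq_norm, PadicInt.norm_le_pow_iff_mem_span_pow, ← PadicInt.ker_toZModPow,
    RingHom.mem_ker, map_sub, sub_eq_zero]

theorem uniformContinuous_moritaSeq {p : ℕ} [hp : Fact p.Prime] (hp2 : p ≠ 2) :
    @UniformContinuous ℕ ℤ_[p]
      (UniformSpace.comap (Nat.cast : ℕ → ℤ_[p]) inferInstance) _ (moritaSeq p) := by
  let _ : UniformSpace ℕ := UniformSpace.comap (Nat.cast : ℕ → ℤ_[p]) inferInstance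
  have hb := (Metric.uniformity_basis_dist (α := ℤ_[p])).comap
    (Prod.map (Nat.cast : ℕ → ℤ_[p]) (Nat.cast : ℕ → ℤ_[p]))
  refine (Filter.HasBasis.uniformContinuous_iff hb Metric.uniformity_basis_dist).2 ?_
  intro ε hε
  obtain ⟨v, hv⟩ := PadicInt.exists_pow_neg_lt p hε
  have hp1 : (1 : ℝ) < p := by exact_mod_cast hp.out.one_lt
  have hp0 : (0 : ℝ) < p := by linarith
  refine ⟨(p : ℝ) ^ (-((v + 1 : ℕ) : ℤ)), zpow_pos hp0 _, fun m n hmn => ?_⟩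
  have h1 := (dist_le_iff_toZModPow (v + 1) (m : ℤ_[p]) (n : ℤ_[p])).1 (le_of_lt hmn)
  rw [map_natCast, map_natCast, ZMod.natCast_eq_natCast_iff] at h1
  have h2 := (dist_le_iff_toZModPow (v + 1) _ _).2
    (toZModPow_moritaSeq_congr hp2 (Nat.succ_ne_zero v) h1)
  refine lt_of_le_of_lt h2 (lt_of_le_of_lt ?_ hv)
  exact zpow_le_zpow_right₀ hp1.le (by push_cast; omega)

theorem continuous_moritaGamma {p : ℕ} [Fact p.Prime] (hp2 : p ≠ 2) :
    Continuous (moritaGamma p) := by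
  let _ : UniformSpace ℕ := UniformSpace.comap (Nat.cast : ℕ → ℤ_[p]) inferInstance
  have hi : IsUniformInducing (Nat.cast : ℕ → ℤ_[p]) := ⟨rfl⟩
  exact (uniformContinuous_uniformly_extend hi PadicInt.denseRange_natCast
    (uniformContinuous_moritaSeq hp2)).continuous

theorem moritaGamma_natCast {p : ℕ} [Fact p.Prime] (hp2 : p ≠ 2) (n : ℕ) :
    moritaGamma p (n : ℤ_[p]) = moritaSeq p n := by
  let _ : UniformSpace ℕ := UniformSpace.comap (Nat.cast : ℕ → ℤ_[p]) inferInstance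
  have hi : IsUniformInducing (Nat.cast : ℕ → ℤ_[p]) := ⟨rfl⟩
  exact uniformly_extend_of_ind hi PadicInt.denseRange_natCast
    (uniformContinuous_moritaSeq hp2) n

theorem moritaGamma_unique {p : ℕ} [Fact p.Prime] (hp2 : p ≠ 2) {f : ℤ_[p] → ℤ_[p]}
    (hf : Continuous f) (hfn : ∀ n : ℕ, f (n : ℤ_[p]) = moritaSeq p n) : f = moritaGamma p :=
  PadicInt.denseRange_natCast.equalizer hf (continuous_moritaGamma hp2)
    (funext fun n => by simp [hfn, moritaGamma_natCast hp2])

/-! Write p = 2n + 1. Modulo p², C(2k,k)/16^k agrees with (-1)^k C(n+k,2k), because 4(n+k+1)(n-k) =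
p² - (2k+1)². The sum is therefore congruent to the third of the moments M_j = ∑ k^j a_k, where a_k
is `legendreSqTerm` at i = 1/4. Telescoping gives two linear relations among M_0, ..., M_3. As
4n(n+1) ≡ -1, eliminating M_2 leaves 10 M_3 ≡ -(n(n+1) M_0 - M_1)
(`ten_mul_legendreSqMoment_three`).

Since ∑ a_k (1-z²)^k = P_n(z)², the Legendre equation at z = 0 identifies n(n+1) M_0 - M_1 with
P_n'(0)². This is 0 for even n, that is p ≡ 1 mod 4, and c² with c = (2m+1) C(2m,m)/4^m for n =
2m+1. The proof obtains both values from recurrences in n (`legendreSqMoment_even`,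
`legendreSqMoment_odd`).

For p = 4m + 3 it remains to see that c² Γ_p(1/4)^4 ≡ 4 (`legendre_coeff_sq_mul_moritaGamma`).
Modulo p², Γ_p is geometric on three-term progressions with step divisible by p, so Γ_p(1/4)² ≡
Γ_p((1+p)/4) Γ_p((1-p)/4). The first factor is ±m!. The second is m+1 unit steps away from Γ_p(1/2),
whose square is 1, and these steps multiply to (2m+1)!!/2^(m+1). -/

/-- The summand `C(n+k, 2k) C(2k, k)^2 (-i)^k`; for `i = 1/4` these are the coefficients of
`P_n(z)^2` in powers of `1 - z^2`, where `P_n` is the Legendre polynomial. -/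
def legendreSqTerm {R : Type*} [CommRing R] (i : R) (n k : ℕ) : R :=
  ((n + k).choose (2 * k) : R) * ((2 * k).choose k : R) ^ 2 * (-i) ^ k

/-! ### Ratios of neighbouring binomial coefficients. -/

theorem choose_add_succ_mul (n k : ℕ) :
    ((n + k + 1).choose (2 * k + 2) : ℤ) * ((2 * k + 2) * (2 * k + 1)) =
      (n + k + 1) * (n - k) * ((n + k).choose (2 * k) : ℤ) := by
  have h1 := Nat.add_one_mul_choose_eq (n + k) (2 * k + 1)
  have h2 := Nat.choose_succ_right_eq (n + k) (2 * k)
  have h1' : ((n : ℤ) + k + 1) * ((n + k).choose (2 * k + 1) : ℤ) =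
      ((n + k + 1).choose (2 * k + 2) : ℤ) * (2 * k + 2) := by exact_mod_cast h1
  have h2' : ((n + k).choose (2 * k + 1) : ℤ) * (2 * k + 1) =
      ((n + k).choose (2 * k) : ℤ) * (n - k) := by
    rcases le_total k n with h | h
    · have : n + k - 2 * k = n - k := by omega
      rw [this] at h2
      have := congrArg (Nat.cast : ℕ → ℤ) h2
      push_cast [h] at this
      exact this
    · rcases h.eq_or_lt with rfl | h
      · have : n + n - 2 * n = 0 := by omega
        rw [this] at h2
        have := congrArg (Nat.cast : ℕ → ℤ) h2
        push_cast at this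
        rw [this]; ring
      · rw [Nat.choose_eq_zero_of_lt (by omega), Nat.choose_eq_zero_of_lt (by omega)]
        simp
  linear_combination (-(2 * (k : ℤ) + 1)) * h1' + ((n : ℤ) + k + 1) * h2'

theorem choose_add_two_mul (n k : ℕ) :
    ((n + k + 2).choose (2 * k + 2) : ℤ) * ((2 * k + 2) * (2 * k + 1)) =
      (n + k + 2) * (n + k + 1) * ((n + k).choose (2 * k) : ℤ) := by
  have h1 := Nat.add_one_mul_choose_eq (n + k + 1) (2 * k + 1)
  have h2 := Nat.add_one_mul_choose_eq (n + k) (2 * k)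
  have h1' : ((n : ℤ) + k + 1 + 1) * ((n + k + 1).choose (2 * k + 1) : ℤ) =
      ((n + k + 2).choose (2 * k + 2) : ℤ) * (2 * k + 1 + 1) := by exact_mod_cast h1
  have h2' : ((n : ℤ) + k + 1) * ((n + k).choose (2 * k) : ℤ) =
      ((n + k + 1).choose (2 * k + 1) : ℤ) * (2 * k + 1) := by exact_mod_cast h2
  linear_combination (-(2 * (k : ℤ) + 1)) * h1' - ((n : ℤ) + k + 2) * h2'

theorem succ_mul_choose_two_mul (k : ℕ) :
    ((k : ℤ) + 1) * ((2 * k + 2).choose (k + 1) : ℤ) = 2 * (2 * k + 1) * ((2 * k).choose k : ℤ) := by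
  have := Nat.succ_mul_centralBinom_succ k
  simp only [Nat.centralBinom_eq_two_mul_choose] at this
  exact_mod_cast this

theorem legendreSqTerm_of_lt {R : Type*} [CommRing R] {i : R} {n k : ℕ} (h : n < k) : legendreSqTerm i n k = 0 := by
  simp [legendreSqTerm, Nat.choose_eq_zero_of_lt (show n + k < 2 * k by omega)]

/-! ### Telescoping identities for the Legendre-square terms. -/

section Moments

variable {R : Type*} [CommRing R] [IsDomain R] [CharZero R] {i : R}

theorem legendreSqTerm_succ (hi : 4 * i = 1) (n k : ℕ) :
    2 * ((k : R) + 1) ^ 3 * legendreSqTerm i n (k + 1) =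
      -((n - k) * (n + k + 1) * (2 * k + 1)) * legendreSqTerm i n k := by
  have h1 := congrArg (Int.cast : ℤ → R) (choose_add_succ_mul n k)
  have h2 := congrArg (Int.cast : ℤ → R) (succ_mul_choose_two_mul k)
  push_cast at h1 h2
  have hk : (2 * (k : R) + 1) ≠ 0 := by exact_mod_cast (by omega : 2 * k + 1 ≠ 0)
  apply mul_left_cancel₀ hk
  unfold legendreSqTerm
  rw [show n + (k + 1) = n + k + 1 by ring, show 2 * (k + 1) = 2 * k + 2 by ring, pow_succ (-i) k]
  generalize ((n + k + 1).choose (2 * k + 2) : R) = y' at *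
  generalize ((n + k).choose (2 * k) : R) = y at *
  generalize ((2 * k + 2).choose (k + 1) : R) = x' at *
  generalize ((2 * k).choose k : R) = x at *
  generalize (-i) ^ k = z at *
  linear_combination (-z * i * ((k + 1) * x') ^ 2) * h1 -
    z * i * (n + k + 1) * (n - k) * y * ((k + 1) * x' + 2 * (2 * k + 1) * x) * h2
    - z * y * x ^ 2 * (n + k + 1) * (n - k) * (2 * k + 1) ^ 2 * hi

theorem legendreSqTerm_succ_succ (hi : 4 * i = 1) (n k : ℕ) :
    2 * ((k : R) + 1) ^ 3 * legendreSqTerm i (n + 1) (k + 1) =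
      -((n + k + 2) * (n + k + 1) * (2 * k + 1)) * legendreSqTerm i n k := by
  have h1 := congrArg (Int.cast : ℤ → R) (choose_add_two_mul n k)
  have h2 := congrArg (Int.cast : ℤ → R) (succ_mul_choose_two_mul k)
  push_cast at h1 h2
  have hk : (2 * (k : R) + 1) ≠ 0 := by exact_mod_cast (by omega : 2 * k + 1 ≠ 0)
  apply mul_left_cancel₀ hk
  unfold legendreSqTerm
  rw [show n + 1 + (k + 1) = n + k + 2 by ring, show 2 * (k + 1) = 2 * k + 2 by ring, pow_succ (-i) k]
  generalize ((n + k + 2).choose (2 * k + 2) : R) = y' at *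
  generalize ((n + k).choose (2 * k) : R) = y at *
  generalize ((2 * k + 2).choose (k + 1) : R) = x' at *
  generalize ((2 * k).choose k : R) = x at *
  generalize (-i) ^ k = z at *
  linear_combination (-z * i * ((k + 1) * x') ^ 2) * h1 -
    z * i * (n + k + 2) * (n + k + 1) * y * ((k + 1) * x' + 2 * (2 * k + 1) * x) * h2
    - z * y * x ^ 2 * (n + k + 2) * (n + k + 1) * (2 * k + 1) ^ 2 * hi


/-- The weight is what makes 2k³a_k telescope: in 2(k+1)³a_{k+1} - 2k³a_k the ratio of terms cancels
the k³ contributions. -/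
theorem sum_legendreSqTerm_quadratic (hi : 4 * i = 1) (n K : ℕ) :
    ∑ k ∈ Finset.range K, (3 * (k : R) ^ 2 + (1 - 2 * (n * (n + 1))) * k - n * (n + 1)) *
      legendreSqTerm i n k = 2 * (K : R) ^ 3 * legendreSqTerm i n K := by
  induction K with
  | zero => simp
  | succ K ih =>
    rw [Finset.sum_range_succ, ih]
    push_cast
    linear_combination -legendreSqTerm_succ hi n K

theorem sum_legendreSqTerm_cubic (hi : 4 * i = 1) (n K : ℕ) :
    ∑ k ∈ Finset.range K, (5 * (k : R) ^ 3 + (4 - 2 * (n * (n + 1))) * k ^ 2 +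
      (1 - 3 * (n * (n + 1))) * k - n * (n + 1)) *
      legendreSqTerm i n k = 2 * (K : R) ^ 4 * legendreSqTerm i n K := by
  induction K with
  | zero => simp
  | succ K ih =>
    rw [Finset.sum_range_succ, ih]
    push_cast
    linear_combination -((K : R) + 1) * legendreSqTerm_succ hi n K

/-- A telescoping certificate in the style of Zeilberger. At K = n + 1 the right side vanishes,
leaving the moment form of P_n'(0)² = (n+1)² P_{n+1}(0)². -/
theorem sum_legendreSqTerm_succ_left (hi : 4 * i = 1) (n K : ℕ) :
    ∑ k ∈ Finset.range (K + 1), (((n : R) + 1) ^ 2 * legendreSqTerm i (n + 1) k -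
      (n * (n + 1) - k) * legendreSqTerm i n k) =
      (n + K + 1) * (2 * K + 1) * legendreSqTerm i n K := by
  induction K with
  | zero =>
    simp [legendreSqTerm]
    ring
  | succ K ih =>
    rw [Finset.sum_range_succ, ih]
    have hk : 2 * ((K : R) + 1) ^ 3 ≠ 0 := by
      exact_mod_cast (by positivity : 2 * (K + 1) ^ 3 ≠ 0)
    apply mul_left_cancel₀ hk
    push_cast
    linear_combination ((n : R) + 1) ^ 2 * legendreSqTerm_succ_succ hi n K -
      ((n * (n + 1) - (K + 1)) + (n + K + 2) * (2 * K + 3)) * legendreSqTerm_succ hi n K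

/-- Companion certificate, whose moment form is P_{n+1}'(0)² = (n+1)² P_n(0)². -/
theorem sum_legendreSqTerm_succ_right (hi : 4 * i = 1) (n K : ℕ) :
    ∑ k ∈ Finset.range (K + 1), ((((n : R) + 1) * (n + 2) - k) * legendreSqTerm i (n + 1) k -
      (n + 1) ^ 2 * legendreSqTerm i n k) =
      (n + K + 1) * (2 * K + 1) * legendreSqTerm i n K := by
  induction K with
  | zero =>
    simp [legendreSqTerm]
    ring
  | succ K ih =>
    rw [Finset.sum_range_succ, ih]
    have hk : 2 * ((K : R) + 1) ^ 3 ≠ 0 := by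
      exact_mod_cast (by positivity : 2 * (K + 1) ^ 3 ≠ 0)
    apply mul_left_cancel₀ hk
    push_cast
    linear_combination (((n : R) + 1) * (n + 2) - (K + 1)) * legendreSqTerm_succ_succ hi n K -
      ((n + 1) ^ 2 + (n + K + 2) * (2 * K + 3)) * legendreSqTerm_succ hi n K

end Moments

/-! ### Relations and recurrences for the moments. -/

/-- The moment `∑ k, k^j a_k` of the terms `a_k = legendreSqTerm i n k`. -/
def legendreSqMoment {R : Type*} [CommRing R] (i : R) (j n : ℕ) : R :=
  ∑ k ∈ Finset.range (n + 1), (k : R) ^ j * legendreSqTerm i n k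

theorem legendreSqMoment_eq_sum_range {R : Type*} [CommRing R] (i : R) (j n : ℕ) :
    legendreSqMoment i j n = ∑ k ∈ Finset.range (n + 2), (k : R) ^ j * legendreSqTerm i n k := by
  rw [Finset.sum_range_succ, legendreSqTerm_of_lt (Nat.lt_succ_self n), mul_zero, add_zero,
    legendreSqMoment]

section Recurrences

variable {R : Type*} [CommRing R] [IsDomain R] [CharZero R] {i : R}

theorem legendreSqMoment_two (hi : 4 * i = 1) (n : ℕ) :
    3 * legendreSqMoment i 2 n + (1 - 2 * (n * (n + 1))) * legendreSqMoment i 1 n -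
      n * (n + 1) * legendreSqMoment i 0 n = 0 := by
  have h := sum_legendreSqTerm_quadratic hi n (n + 1)
  rw [legendreSqTerm_of_lt (Nat.lt_succ_self n), mul_zero] at h
  rw [← h]
  simp only [legendreSqMoment, Finset.mul_sum, ← Finset.sum_add_distrib, ← Finset.sum_sub_distrib]
  exact Finset.sum_congr rfl fun k _ => by ring

theorem legendreSqMoment_three (hi : 4 * i = 1) (n : ℕ) :
    5 * legendreSqMoment i 3 n + (4 - 2 * (n * (n + 1))) * legendreSqMoment i 2 n +
      (1 - 3 * (n * (n + 1))) * legendreSqMoment i 1 n -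
      n * (n + 1) * legendreSqMoment i 0 n = 0 := by
  have h := sum_legendreSqTerm_cubic hi n (n + 1)
  rw [legendreSqTerm_of_lt (Nat.lt_succ_self n), mul_zero] at h
  rw [← h]
  simp only [legendreSqMoment, Finset.mul_sum, ← Finset.sum_add_distrib, ← Finset.sum_sub_distrib]
  exact Finset.sum_congr rfl fun k _ => by ring

theorem legendreSqMoment_zero_succ (hi : 4 * i = 1) (n : ℕ) :
    ((n : R) + 1) ^ 2 * legendreSqMoment i 0 (n + 1) =
      n * (n + 1) * legendreSqMoment i 0 n - legendreSqMoment i 1 n := by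
  have h := sum_legendreSqTerm_succ_left hi n (n + 1)
  rw [legendreSqTerm_of_lt (Nat.lt_succ_self n), mul_zero] at h
  rw [← sub_eq_zero, ← h, legendreSqMoment_eq_sum_range i 0 n, legendreSqMoment_eq_sum_range i 1 n]
  simp only [legendreSqMoment, Finset.mul_sum, ← Finset.sum_sub_distrib]
  exact Finset.sum_congr rfl fun k _ => by ring

theorem legendreSqMoment_one_succ (hi : 4 * i = 1) (n : ℕ) :
    ((n : R) + 1) * (n + 2) * legendreSqMoment i 0 (n + 1) - legendreSqMoment i 1 (n + 1) =
      (n + 1) ^ 2 * legendreSqMoment i 0 n := by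
  have h := sum_legendreSqTerm_succ_right hi n (n + 1)
  rw [legendreSqTerm_of_lt (Nat.lt_succ_self n), mul_zero] at h
  rw [← sub_eq_zero, ← h, legendreSqMoment_eq_sum_range i 0 n]
  simp only [legendreSqMoment, Finset.mul_sum, ← Finset.sum_sub_distrib]
  exact Finset.sum_congr rfl fun k _ => by ring

/-- Eliminating M_0(n+1) between the two neighbouring relations gives a two-step recurrence for
P_n'(0)² alone, which fixes it separately on even and odd n. -/
theorem legendreSqMoment_add_two (hi : 4 * i = 1) (n : ℕ) :
    ((n : R) + 1) ^ 2 * (((n : R) + 2) * (n + 3) * legendreSqMoment i 0 (n + 2) -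
      legendreSqMoment i 1 (n + 2)) =
      (n + 2) ^ 2 * (n * (n + 1) * legendreSqMoment i 0 n - legendreSqMoment i 1 n) := by
  have h1 := legendreSqMoment_one_succ hi (n + 1)
  have h2 := legendreSqMoment_zero_succ hi n
  push_cast at h1
  linear_combination ((n : R) + 1) ^ 2 * h1 + ((n : R) + 2) ^ 2 * h2

theorem legendreSqMoment_even (hi : 4 * i = 1) (m : ℕ) :
    ((2 * m : ℕ) : R) * ((2 * m : ℕ) + 1) * legendreSqMoment i 0 (2 * m) -
      legendreSqMoment i 1 (2 * m) = 0 := by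
  induction m with
  | zero => simp [legendreSqMoment]
  | succ m ih =>
    have h := legendreSqMoment_add_two hi (2 * m)
    rw [ih, mul_zero] at h
    have hk : (((2 * m : ℕ) : R) + 1) ^ 2 ≠ 0 := by
      exact_mod_cast (by positivity : (2 * m + 1) ^ 2 ≠ 0)
    have h' := (mul_eq_zero.1 h).resolve_left hk
    rw [← h', show 2 * (m + 1) = 2 * m + 2 by ring]
    push_cast
    ring

theorem legendreSqMoment_odd (hi : 4 * i = 1) (m : ℕ) :
    ((2 * m + 1 : ℕ) : R) * ((2 * m + 1 : ℕ) + 1) * legendreSqMoment i 0 (2 * m + 1) -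
      legendreSqMoment i 1 (2 * m + 1) = ((2 * m + 1) * ((2 * m).choose m : R) * i ^ m) ^ 2 := by
  induction m with
  | zero =>
    have h := legendreSqMoment_one_succ hi 0
    simp only [legendreSqMoment, legendreSqTerm] at h ⊢
    simp at h ⊢
    linear_combination h
  | succ m ih =>
    have h := legendreSqMoment_add_two hi (2 * m + 1)
    rw [ih] at h
    have hk : (((2 * m + 1 : ℕ) : R) + 1) ^ 2 ≠ 0 := by
      exact_mod_cast (by positivity : (2 * m + 1 + 1) ^ 2 ≠ 0)
    have hx := congrArg (Int.cast : ℤ → R) (succ_mul_choose_two_mul m)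
    apply mul_left_cancel₀ hk
    rw [show 2 * (m + 1) + 1 = 2 * m + 1 + 2 by ring, show 2 * (m + 1) = 2 * m + 2 by ring]
    push_cast at h hx ⊢
    rw [pow_succ i m]
    generalize legendreSqMoment i 0 (2 * m + 1 + 2) = A at *
    generalize legendreSqMoment i 1 (2 * m + 1 + 2) = B at *
    generalize ((2 * m + 2).choose (m + 1) : R) = x' at *
    generalize ((2 * m).choose m : R) = x at *
    generalize i ^ m = z at *
    linear_combination h - (2 * (m : R) + 3) ^ 2 * (2 * i * z) ^ 2 *
      ((m + 1) * x' + 2 * (2 * m + 1) * x) * hx -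
      (2 * (m : R) + 3) ^ 2 * z ^ 2 * (2 * m + 1) ^ 2 * x ^ 2 * (4 * i + 1) * hi

end Recurrences

/-! ### Morita's Gamma function modulo p². -/

/-- The factor of `moritaSeq` at `k`, reduced modulo `p ^ 2`. -/
def moritaFactor (p k : ℕ) : ZMod (p ^ 2) := if k.Coprime p then (k : ZMod (p ^ 2)) else 1

section Morita

variable {p : ℕ} [hp : Fact p.Prime]

/-- `moritaSeq` reduced modulo `p ^ 2`. -/
noncomputable def moritaMod (p : ℕ) [Fact p.Prime] (n : ℕ) : ZMod (p ^ 2) :=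
  PadicInt.toZModPow 2 (moritaSeq p n)

theorem moritaMod_succ (n : ℕ) : moritaMod p (n + 1) = -moritaFactor p n * moritaMod p n := by
  rw [moritaMod, moritaSeq_succ, moritaMod, moritaFactor]
  split_ifs <;> simp

theorem moritaMod_zero : moritaMod p 0 = 1 := by
  simp [moritaMod, moritaSeq]

theorem moritaMod_congr (hp2 : p ≠ 2) {m n : ℕ} (h : m ≡ n [MOD p ^ 2]) :
    moritaMod p m = moritaMod p n :=
  toZModPow_moritaSeq_congr hp2 two_ne_zero h

theorem moritaFactor_of_dvd {k : ℕ} (h : p ∣ k) : moritaFactor p k = 1 := by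
  rw [moritaFactor, if_neg]
  rw [Nat.coprime_comm, hp.out.coprime_iff_not_dvd]
  exact not_not.2 h

theorem moritaFactor_of_not_dvd {k : ℕ} (h : ¬ p ∣ k) : moritaFactor p k = k := by
  rw [moritaFactor, if_pos]
  rwa [Nat.coprime_comm, hp.out.coprime_iff_not_dvd]

theorem isUnit_natCast_zmod_sq {k : ℕ} (h : ¬ p ∣ k) : IsUnit (k : ZMod (p ^ 2)) := by
  rw [ZMod.isUnit_iff_coprime]
  exact (Nat.coprime_comm.1 (hp.out.coprime_iff_not_dvd.2 h)).pow_right 2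

/-- Raising b and lowering c by one exchanges the factors at b + 1 and at c ≡ -(b + 1), so the sign
flips unless p divides b + 1. The term b / p in the exponent counts these exceptions. -/
theorem moritaMod_reflection (hp2 : p ≠ 2) (b c : ℕ) (hbc : b + c = p ^ 2) :
    moritaFactor p b * (moritaMod p b * moritaMod p c) = (-1) ^ (b + b / p) := by
  induction b generalizing c with
  | zero =>
    have : moritaMod p c = moritaMod p 0 := moritaMod_congr hp2 (by
      rw [show c = p ^ 2 by omega]; simp [Nat.ModEq])
    rw [this, moritaMod_zero, moritaFactor_of_dvd (dvd_zero p)]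
    simp
  | succ b ih =>
    have h := ih (c + 1) (by omega)
    rw [moritaMod_succ c] at h
    rw [moritaMod_succ b, Nat.succ_div]
    have hq : p ∣ (b + 1) + c := hbc ▸ dvd_pow_self p two_ne_zero
    have hdvd : p ∣ b + 1 ↔ p ∣ c :=
      ⟨fun h => (Nat.dvd_add_right h).1 hq, fun h => (Nat.dvd_add_left h).1 hq⟩
    by_cases hd : p ∣ b + 1
    · rw [moritaFactor_of_dvd (hdvd.1 hd)] at h
      rw [if_pos hd, moritaFactor_of_dvd hd, show b + 1 + (b / p + 1) = b + b / p + 2 by ring,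
        pow_add, ← h]
      ring
    · rw [moritaFactor_of_not_dvd (mt hdvd.2 hd)] at h
      have hc : (c : ZMod (p ^ 2)) = -((b + 1 : ℕ) : ZMod (p ^ 2)) := by
        rw [eq_neg_iff_add_eq_zero, ← Nat.cast_add, show c + (b + 1) = p ^ 2 by omega,
          ZMod.natCast_self]
      rw [if_neg hd, moritaFactor_of_not_dvd hd, add_zero,
        show b + 1 + b / p = b + b / p + 1 by ring]
      rw [hc] at h
      linear_combination -h

/-- Away from multiples of p this is (a+2b)a = (a+b)² - b² with b² ≡ 0. -/
theorem moritaFactor_mul_eq_sq {b : ℕ} (hb : p ∣ b) (a : ℕ) :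
    moritaFactor p (a + 2 * b) * moritaFactor p a = moritaFactor p (a + b) ^ 2 := by
  have h1 : p ∣ a + b ↔ p ∣ a := (Nat.dvd_add_iff_left hb).symm
  have h2 : p ∣ a + 2 * b ↔ p ∣ a := (Nat.dvd_add_iff_left (hb.mul_left 2)).symm
  by_cases h : p ∣ a
  · rw [moritaFactor_of_dvd h, moritaFactor_of_dvd (h1.2 h), moritaFactor_of_dvd (h2.2 h)]
    ring
  · rw [moritaFactor_of_not_dvd h, moritaFactor_of_not_dvd (mt h1.1 h),
      moritaFactor_of_not_dvd (mt h2.1 h)]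
    have : ((b ^ 2 : ℕ) : ZMod (p ^ 2)) = 0 := (ZMod.natCast_eq_zero_iff _ _).2 (pow_dvd_pow_of_dvd hb 2)
    push_cast at this ⊢
    linear_combination -this

/-- By `moritaFactor_mul_eq_sq`, the relation passes from a to a + 1, so one starting point
suffices. -/
theorem moritaMod_mul_eq_sq (hp2 : p ≠ 2) {u : ℕ} (hu : u < p) (a : ℕ) :
    moritaMod p (a + 2 * (p * u)) * moritaMod p a = moritaMod p (a + p * u) ^ 2 := by
  have hlt : p * u ≤ p ^ 2 := by rw [sq]; exact Nat.mul_le_mul_left p hu.le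
  obtain ⟨c, hc⟩ := Nat.exists_eq_add_of_le hlt
  -- The induction starts at c ≡ -pu, where the claim is Γ_p(pu) Γ_p(-pu) ≡ Γ_p(0)², an instance of
  -- reflection. Taking t = a + pu then returns to a modulo p².
  have step : ∀ t, moritaMod p (c + t + 2 * (p * u)) * moritaMod p (c + t) =
      moritaMod p (c + t + p * u) ^ 2 := by
    intro t
    induction t with
    | zero =>
      have h1 : moritaMod p (c + 0 + 2 * (p * u)) = moritaMod p (p * u) :=
        moritaMod_congr hp2 (by
          rw [show c + 0 + 2 * (p * u) = p * u + p ^ 2 by omega]; simp [Nat.ModEq])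
      have h2 : moritaMod p (c + 0 + p * u) = moritaMod p 0 :=
        moritaMod_congr hp2 (by
          rw [show c + 0 + p * u = p ^ 2 by omega]; simp [Nat.ModEq])
      have h3 := moritaMod_reflection hp2 (p * u) c hc.symm
      rw [moritaFactor_of_dvd (dvd_mul_right p u), Nat.mul_div_cancel_left _ hp.out.pos] at h3
      have hev : Even (p * u + u) := by
        have := (hp.out.odd_of_ne_two hp2).add_one
        rw [show p * u + u = (p + 1) * u by ring]
        exact this.mul_right u
      rw [hev.neg_one_pow, one_mul] at h3
      rw [h1, h2, moritaMod_zero, add_zero, h3, one_pow]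
    | succ t ih =>
      have hf := moritaFactor_mul_eq_sq (dvd_mul_right p u) (c + t)
      rw [show c + (t + 1) + 2 * (p * u) = c + t + 2 * (p * u) + 1 by ring,
        show c + (t + 1) + p * u = c + t + p * u + 1 by ring,
        show c + (t + 1) = c + t + 1 by ring, moritaMod_succ, moritaMod_succ, moritaMod_succ]
      linear_combination moritaFactor p (c + t + 2 * (p * u)) * moritaFactor p (c + t) * ih +
        moritaMod p (c + t + p * u) ^ 2 * hf
  have h := step (a + p * u)
  have e : ∀ x, moritaMod p (x + p ^ 2) = moritaMod p x := fun x =>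
    moritaMod_congr hp2 (by simp [Nat.ModEq])
  rw [show c + (a + p * u) + 2 * (p * u) = a + 2 * (p * u) + p ^ 2 by omega,
    show c + (a + p * u) + p * u = a + p * u + p ^ 2 by omega,
    show c + (a + p * u) = a + p ^ 2 by omega, e, e, e] at h
  exact h

theorem toZModPow_moritaGamma (hp2 : p ≠ 2) {x : ℤ_[p]} {a : ℕ}
    (h : PadicInt.toZModPow 2 x = (a : ZMod (p ^ 2))) :
    PadicInt.toZModPow 2 (moritaGamma p x) = moritaMod p a := by
  have hp0 : (0 : ℝ) < (p : ℝ) ^ (-((2 : ℕ) : ℤ)) := zpow_pos (by exact_mod_cast hp.out.pos) _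
  have ho : IsOpen (Metric.ball x ((p : ℝ) ^ (-((2 : ℕ) : ℤ))) ∩
      moritaGamma p ⁻¹' Metric.ball (moritaGamma p x) ((p : ℝ) ^ (-((2 : ℕ) : ℤ)))) :=
    Metric.isOpen_ball.inter (Metric.isOpen_ball.preimage (continuous_moritaGamma hp2))
  obtain ⟨n, hn1, hn2⟩ := (PadicInt.denseRange_natCast (p := p)).exists_mem_open ho
    ⟨x, Metric.mem_ball_self hp0, Metric.mem_ball_self hp0⟩
  have h1 := (dist_le_iff_toZModPow 2 _ _).1 (Metric.mem_ball.1 hn1).le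
  have h2 := (dist_le_iff_toZModPow 2 _ _).1 (Metric.mem_ball.1 hn2).le
  rw [← h2, moritaGamma_natCast hp2]
  rw [h, map_natCast, ZMod.natCast_eq_natCast_iff] at h1
  exact moritaMod_congr hp2 h1

theorem moritaMod_of_lt (n : ℕ) (hn : n < p) :
    moritaMod p (n + 1) = (-1) ^ (n + 1) * (n.factorial : ZMod (p ^ 2)) := by
  induction n with
  | zero => rw [moritaMod_succ, moritaMod_zero, moritaFactor_of_dvd (dvd_zero p)]; simp
  | succ n ih =>
    rw [moritaMod_succ, ih (by omega),
      moritaFactor_of_not_dvd (Nat.not_dvd_of_pos_of_lt n.succ_pos hn), Nat.factorial_succ]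
    push_cast
    ring

/-- For `p ≡ 3 [MOD 4]`, `Γ_p(1/2) ^ 2 = 1` modulo `p ^ 2`. -/
theorem moritaMod_half_sq {h : ℕ} (hh : 2 * h = p ^ 2 + 1) (h4 : p % 4 = 3) :
    moritaMod p h ^ 2 = 1 := by
  have hp2 : p ≠ 2 := by rintro rfl; omega
  obtain ⟨m, hm⟩ : ∃ m, p = 4 * m + 3 := ⟨p / 4, by omega⟩
  obtain ⟨g, rfl⟩ : ∃ g, h = g + 1 := ⟨h - 1, by have := pow_pos hp.out.pos 2; omega⟩
  have hpp : p ^ 2 = p * (4 * m + 3) := by rw [sq]; nth_rewrite 2 [hm]; rfl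
  have e0 : ((p : ZMod (p ^ 2))) ^ 2 = 0 := by
    exact_mod_cast ZMod.natCast_self (p ^ 2)
  -- Here g + 1 represents 1/2 and g represents -1/2, so the reflection formula becomes a formula
  -- for the square at 1/2.
  have hr := moritaMod_reflection hp2 (g + 1) g (by omega)
  have hdiv : (g + 1) / p = 2 * m + 1 := by
    refine Nat.div_eq_of_lt_le ?_ ?_ <;> nlinarith
  have hg : g = 8 * m ^ 2 + 12 * m + 4 := by
    have : p ^ 2 = (4 * m + 3) ^ 2 := by rw [← hm]
    nlinarith
  have hnd1 : ¬ p ∣ g + 1 := by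
    intro hd
    have : p ∣ 2 * (g + 1) := hd.mul_left 2
    rw [hh, Nat.dvd_add_right (dvd_pow_self p two_ne_zero)] at this
    exact hp.out.one_lt.ne' (Nat.dvd_one.1 this)
  have hnd : ¬ p ∣ g := by
    intro hd
    have h1 : p ∣ 2 * g + 1 := by
      rw [show 2 * g + 1 = p ^ 2 by omega]; exact dvd_pow_self p two_ne_zero
    rw [Nat.dvd_add_right (hd.mul_left 2)] at h1
    exact hp.out.one_lt.ne' (Nat.dvd_one.1 h1)
  have hev : Even (g + 1 + (g + 1) / p) := by
    rw [hdiv, hg]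
    exact ⟨4 * m ^ 2 + 7 * m + 3, by ring⟩
  rw [hev.neg_one_pow, moritaFactor_of_not_dvd hnd1, moritaMod_succ,
    moritaFactor_of_not_dvd hnd] at hr
  have h2 : (2 : ZMod (p ^ 2)) * (g + 1) = 1 := by
    have := congrArg (Nat.cast : ℕ → ZMod (p ^ 2)) hh
    push_cast at this
    rw [this, e0, zero_add]
  rw [moritaMod_succ, moritaFactor_of_not_dvd hnd]
  push_cast at hr
  have h3 : (g : ZMod (p ^ 2)) = -(g + 1) := by linear_combination h2
  linear_combination hr + (g : ZMod (p ^ 2)) * moritaMod p g ^ 2 * h2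

theorem moritaMod_add (a n : ℕ) (h : ∀ j < n, ¬ p ∣ a + j) :
    moritaMod p (a + n) = moritaMod p a * ∏ j ∈ Finset.range n, (-((a + j : ℕ) : ZMod (p ^ 2))) := by
  induction n with
  | zero => simp
  | succ n ih =>
    rw [← add_assoc, moritaMod_succ, ih fun j hj => h j (by omega), Finset.prod_range_succ,
      moritaFactor_of_not_dvd (h n n.lt_succ_self)]
    ring

end Morita

/-! ### Reduction of the sum and of the Legendre value modulo p². -/

section Congruences

variable {p : ℕ} [hp : Fact p.Prime]

/-- Both sides have the same ratio of consecutive terms, since 4(n+k+1)(n-k) ≡ -(2k+1)² modulo p².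
The denominators k+1 and 2k+1 are units because they lie below p. -/
theorem choose_two_mul_mul_pow_eq {n : ℕ} (hn : p = 2 * n + 1) {i : ZMod (p ^ 2)}
    (hi : 4 * i = 1) {k : ℕ} (hk : k ≤ n) :
    ((2 * k).choose k : ZMod (p ^ 2)) * i ^ (2 * k) =
      (-1) ^ k * ((n + k).choose (2 * k) : ZMod (p ^ 2)) := by
  induction k with
  | zero => simp
  | succ k ih =>
    have h := ih (by omega)
    have h1 := congrArg (Int.cast : ℤ → ZMod (p ^ 2)) (choose_add_succ_mul n k)
    have h2 := congrArg (Int.cast : ℤ → ZMod (p ^ 2)) (succ_mul_choose_two_mul k)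
    push_cast at h1 h2
    have hnd : ∀ j, 0 < j → j < p → IsUnit (j : ZMod (p ^ 2)) := fun j h0 hj =>
      isUnit_natCast_zmod_sq (Nat.not_dvd_of_pos_of_lt h0 hj)
    have hu : IsUnit ((8 : ZMod (p ^ 2)) * (k + 1) * (2 * k + 1)) := by
      have h8 : IsUnit (8 : ZMod (p ^ 2)) :=
        IsUnit.of_mul_eq_one (8 * i ^ 3) (by linear_combination (16 * i ^ 2 + 4 * i + 1) * hi)
      have ha := hnd (k + 1) (by omega) (by omega)
      have hb := hnd (2 * k + 1) (by omega) (by omega)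
      push_cast at ha hb
      exact (h8.mul ha).mul hb
    have hpn : (2 * (n : ZMod (p ^ 2)) + 1) ^ 2 = 0 := by
      have : (((2 * n + 1) ^ 2 : ℕ) : ZMod (p ^ 2)) = 0 := by rw [← hn, ZMod.natCast_self]
      exact_mod_cast this
    apply hu.mul_left_cancel
    rw [show n + (k + 1) = n + k + 1 by ring, show 2 * (k + 1) = 2 * k + 2 by ring,
      pow_add i, pow_succ (-1 : ZMod (p ^ 2)) k]
    generalize ((n + k + 1).choose (2 * k + 2) : ZMod (p ^ 2)) = y' at *
    generalize ((n + k).choose (2 * k) : ZMod (p ^ 2)) = y at *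
    generalize ((2 * k + 2).choose (k + 1) : ZMod (p ^ 2)) = x' at *
    generalize ((2 * k).choose k : ZMod (p ^ 2)) = x at *
    generalize i ^ (2 * k) = z at *
    generalize (-1 : ZMod (p ^ 2)) ^ k = s at *
    linear_combination 8 * (2 * k + 1) * z * i ^ 2 * h2 + (2 * (k : ZMod (p ^ 2)) + 1) ^ 2 * h
      + 4 * s * h1 + s * y * hpn
      + (2 * (k : ZMod (p ^ 2)) + 1) ^ 2 * z * x * (4 * i + 1) * hi

/-- For `p = 2 n + 1`, the third moment modulo `p ^ 2` in terms of the first two. -/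
theorem ten_mul_legendreSqMoment_three {n : ℕ} (hn : p = 2 * n + 1) (hp3 : 3 < p) {i : ℤ_[p]}
    (hi : 4 * i = 1) :
    PadicInt.toZModPow 2 (10 * legendreSqMoment i 3 n) =
      -PadicInt.toZModPow 2 ((n : ℤ_[p]) * ((n : ℤ_[p]) + 1) * legendreSqMoment i 0 n - legendreSqMoment i 1 n) := by
  have h2 := congrArg (PadicInt.toZModPow 2) (legendreSqMoment_two hi n)
  have h3 := congrArg (PadicInt.toZModPow 2) (legendreSqMoment_three hi n)
  have hi' := congrArg (PadicInt.toZModPow 2) hi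
  simp only [map_add, map_sub, map_mul, map_natCast, map_one, map_ofNat, map_zero] at h2 h3 hi' ⊢
  have hpn : (2 * (n : ZMod (p ^ 2)) + 1) ^ 2 = 0 := by
    have : (((2 * n + 1) ^ 2 : ℕ) : ZMod (p ^ 2)) = 0 := by rw [← hn, ZMod.natCast_self]
    exact_mod_cast this
  have hu3 : IsUnit (3 : ZMod (p ^ 2)) := by
    have := isUnit_natCast_zmod_sq (p := p) (k := 3)
      (Nat.not_dvd_of_pos_of_lt (by norm_num) hp3)
    exact_mod_cast this
  have hN : (n : ZMod (p ^ 2)) * (n + 1) = -PadicInt.toZModPow 2 i := by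
    linear_combination PadicInt.toZModPow 2 i * hpn - (n : ZMod (p ^ 2)) * (n + 1) * hi'
  rw [hN] at h2 h3 ⊢
  generalize PadicInt.toZModPow 2 (legendreSqMoment i 0 n) = A at *
  generalize PadicInt.toZModPow 2 (legendreSqMoment i 1 n) = B at *
  generalize PadicInt.toZModPow 2 (legendreSqMoment i 2 n) = C at *
  generalize PadicInt.toZModPow 2 (legendreSqMoment i 3 n) = D at *
  generalize PadicInt.toZModPow 2 i = j at *
  apply hu3.mul_left_cancel
  -- The multipliers 6 and 8 + 4j are chosen so that the second moment C cancels once n(n+1) is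
  -- replaced by -j.
  linear_combination 6 * h3 - (8 + 4 * j) * h2 + (B * (2 * j + 1) + A * j) * hi'

theorem two_pow_mul_prod_odd (m : ℕ) :
    2 ^ m * ∏ t ∈ Finset.range (m + 1), (2 * (t : ℤ) + 1) =
      (2 * m + 1) * ((2 * m).choose m : ℤ) * m.factorial := by
  induction m with
  | zero => simp
  | succ m ih =>
    have h := succ_mul_choose_two_mul m
    rw [Finset.prod_range_succ, Nat.factorial_succ, show 2 * (m + 1) = 2 * m + 2 by ring]
    push_cast
    linear_combination 2 * (2 * (m : ℤ) + 3) * ih - (2 * m + 3) * (m.factorial : ℤ) * h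

theorem legendre_coeff_sq_mul_moritaGamma {m : ℕ} (hm : p = 4 * m + 3) {i : ℤ_[p]}
    (hi : 4 * i = 1) :
    PadicInt.toZModPow 2 (((2 * (m : ℤ_[p]) + 1) * ((2 * m).choose m : ℤ_[p]) * i ^ m) ^ 2 *
      moritaGamma p i ^ 4) = 4 := by
  have hp2 : p ≠ 2 := by omega
  have hi' := congrArg (PadicInt.toZModPow 2) hi
  have e0 : (p : ZMod (p ^ 2)) ^ 2 = 0 := by
    exact_mod_cast ZMod.natCast_self (p ^ 2)
  have ep : (p : ZMod (p ^ 2)) = 4 * m + 3 := by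
    have := congrArg (Nat.cast : ℕ → ZMod (p ^ 2)) hm
    push_cast at this
    exact this
  simp only [map_mul, map_one, map_ofNat] at hi'
  -- 4(m + 1 + p(3m+2)) = 1 + 3p², so this natural number represents 1/4. It is the midpoint of m +
  -- 1 = (1+p)/4 and m + 1 + 2p(3m+2) ≡ (1-p)/4.
  have hG : PadicInt.toZModPow 2 (moritaGamma p i) = moritaMod p (m + 1 + p * (3 * m + 2)) := by
    apply toZModPow_moritaGamma hp2
    have h4 : IsUnit (4 : ZMod (p ^ 2)) := IsUnit.of_mul_eq_one _ hi'
    apply h4.mul_left_cancel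
    rw [hi']
    push_cast
    linear_combination (1 + 3 * (p : ZMod (p ^ 2))) * ep - 3 * e0
  simp only [map_mul, map_pow, map_add, map_natCast, map_one, map_ofNat]
  rw [hG]
  generalize PadicInt.toZModPow 2 i = j at *
  have hsq := moritaMod_mul_eq_sq hp2 (show 3 * m + 2 < p by omega) (m + 1)
  have h0 := moritaMod_of_lt (p := p) m (by omega)
  have hcast : ∀ t : ℕ, -((m + 1 + 2 * (p * (3 * m + 2)) + t : ℕ) : ZMod (p ^ 2)) * 2 =
      2 * (m - t) + 1 := by
    intro t
    push_cast
    linear_combination (1 + 3 * (p : ZMod (p ^ 2))) * ep - 3 * e0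
  have hadd := moritaMod_add (p := p) (m + 1 + 2 * (p * (3 * m + 2))) (m + 1) (by
    intro t ht hd
    rw [show m + 1 + 2 * (p * (3 * m + 2)) + t = m + 1 + t + p * (2 * (3 * m + 2)) by ring,
      Nat.dvd_add_left (dvd_mul_right _ _)] at hd
    exact Nat.not_dvd_of_pos_of_lt (by omega) (by omega) hd)
  obtain ⟨h, hh⟩ : ∃ h, 2 * h = p ^ 2 + 1 := by
    obtain ⟨h, hh⟩ := ((hp.out.odd_of_ne_two hp2).pow (n := 2)).add_one
    exact ⟨h, by omega⟩
  -- (1-p)/4 + (1+p)/4 = 1/2.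
  have hhalf : moritaMod p (m + 1 + 2 * (p * (3 * m + 2)) + (m + 1)) ^ 2 = 1 := by
    have : moritaMod p (m + 1 + 2 * (p * (3 * m + 2)) + (m + 1)) = moritaMod p h := by
      apply moritaMod_congr hp2
      have : m + 1 + 2 * (p * (3 * m + 2)) + (m + 1) = h + p ^ 2 := by
        have : p * (12 * m + 9) = 3 * p ^ 2 := by
          rw [show 12 * m + 9 = 3 * p by omega]; ring
        have e : p * (12 * m + 9) = 2 * (2 * (p * (3 * m + 2))) + p := by ring
        omega
      rw [this]
      simp [Nat.ModEq]
    rw [this, moritaMod_half_sq hh (by omega)]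
  rw [hadd] at hhalf
  -- Doubling each of the m + 1 factors between (1-p)/4 and 1/2 turns them into the odd numbers
  -- 2m+1, ..., 3, 1, in decreasing order.
  have hprod : (2 : ZMod (p ^ 2)) ^ (m + 1) * ∏ t ∈ Finset.range (m + 1),
      (-((m + 1 + 2 * (p * (3 * m + 2)) + t : ℕ) : ZMod (p ^ 2))) =
      ∏ t ∈ Finset.range (m + 1), (2 * (t : ZMod (p ^ 2)) + 1) := by
    have h2 : (2 : ZMod (p ^ 2)) ^ (m + 1) = ∏ _t ∈ Finset.range (m + 1), (2 : ZMod (p ^ 2)) := by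
      rw [Finset.prod_const, Finset.card_range]
    rw [← Finset.prod_range_reflect (fun t => 2 * (t : ZMod (p ^ 2)) + 1), mul_comm, h2,
      ← Finset.prod_mul_distrib]
    refine Finset.prod_congr rfl fun t ht => ?_
    rw [hcast, Nat.add_sub_cancel, Nat.cast_sub (Nat.lt_succ_iff.1 (Finset.mem_range.1 ht))]
  have hodd := congrArg (Int.cast : ℤ → ZMod (p ^ 2)) (two_pow_mul_prod_odd m)
  push_cast at hodd
  have hfac : IsUnit (m.factorial : ZMod (p ^ 2)) :=
    isUnit_natCast_zmod_sq (fun hd => by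
      have := (hp.out.dvd_factorial).1 hd
      omega)
  have hz : ((2 : ZMod (p ^ 2)) ^ m) ^ 2 * j ^ m = 1 := by
    rw [← pow_mul, mul_comm m 2, pow_mul, ← mul_pow, show (2 : ZMod (p ^ 2)) ^ 2 = 4 by norm_num,
      hi', one_pow]
  have h0' : moritaMod p (m + 1) ^ 2 = (m.factorial : ZMod (p ^ 2)) ^ 2 := by
    rw [h0, mul_pow, ← pow_mul, mul_comm (m + 1) 2, pow_mul]
    simp
  rw [pow_succ (2 : ZMod (p ^ 2)) m] at hprod
  apply (hfac.pow 2).mul_left_cancel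
  generalize ∏ t ∈ Finset.range (m + 1),
      (-((m + 1 + 2 * (p * (3 * m + 2)) + t : ℕ) : ZMod (p ^ 2))) = P at *
  generalize ∏ t ∈ Finset.range (m + 1), (2 * (t : ZMod (p ^ 2)) + 1) = O at *
  generalize (2 : ZMod (p ^ 2)) ^ m = w at *
  generalize j ^ m = z at *
  generalize moritaMod p (m + 1 + 2 * (p * (3 * m + 2))) = G2 at *
  generalize moritaMod p (m + 1 + p * (3 * m + 2)) = G1 at *
  generalize moritaMod p (m + 1) = G0 at *
  generalize (m.factorial : ZMod (p ^ 2)) = F at *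
  generalize ((2 * m).choose m : ZMod (p ^ 2)) = x at *
  calc F ^ 2 * (((2 * (m : ZMod (p ^ 2)) + 1) * x * z) ^ 2 * G1 ^ 4)
      = ((2 * (m : ZMod (p ^ 2)) + 1) * x * F) ^ 2 * z ^ 2 * (G1 ^ 2) ^ 2 := by ring
    _ = (w ^ 2 * z) ^ 2 * 4 * (G2 * P) ^ 2 * G0 ^ 2 := by
        rw [← hodd, ← hsq, ← hprod]
        ring
    _ = F ^ 2 * 4 := by
        rw [hz, hhalf, h0']
        ring

theorem padicModEq_of_toZModPow_eq {x y : ℤ_[p]}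
    (h : PadicInt.toZModPow 2 x = PadicInt.toZModPow 2 y) :
    PadicModEq p (p ^ 2) (x : ℚ_[p]) (y : ℚ_[p]) := by
  have hk : x - y ∈ RingHom.ker (PadicInt.toZModPow (p := p) 2) := by
    rw [RingHom.mem_ker, map_sub, h, sub_self]
  rw [PadicInt.ker_toZModPow, Ideal.mem_span_singleton] at hk
  obtain ⟨z, hz⟩ := hk
  refine ⟨z, ?_⟩
  rw [← PadicInt.coe_sub, hz]
  push_cast
  ring

theorem isUnit_natCast_padicInt {k : ℕ} (h : ¬ p ∣ k) : IsUnit (k : ℤ_[p]) := by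
  rw [PadicInt.isUnit_iff]
  refine le_antisymm (PadicInt.norm_le_one _) (not_lt.1 fun hlt => h ?_)
  have := (PadicInt.norm_int_lt_one_iff_dvd (p := p) (k : ℤ)).1 (by exact_mod_cast hlt)
  exact_mod_cast this

theorem isUnit_of_isUnit_toZModPow_two {x : ℤ_[p]} (h : IsUnit (PadicInt.toZModPow 2 x)) :
    IsUnit x := by
  have : Fact (1 < p ^ 2) := ⟨Nat.one_lt_pow two_ne_zero hp.out.one_lt⟩
  have := IsLocalHom.of_surjective (PadicInt.toZModPow (p := p) 2) (ZMod.ringHom_surjective _)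
  exact isUnit_of_map_unit _ _ h

theorem toZModPow_sum_eq_legendreSqMoment {n : ℕ} (hn : p = 2 * n + 1) {i : ℤ_[p]}
    (hi : 4 * i = 1) :
    PadicInt.toZModPow 2 (∑ k ∈ Finset.range (n + 1),
      (k : ℤ_[p]) ^ 3 * ((2 * k).choose k : ℤ_[p]) ^ 3 * (i ^ 3) ^ k) =
      PadicInt.toZModPow 2 (legendreSqMoment i 3 n) := by
  have hi' := congrArg (PadicInt.toZModPow 2) hi
  simp only [map_mul, map_one, map_ofNat] at hi'
  simp only [legendreSqMoment, legendreSqTerm, map_sum, map_mul, map_pow, map_natCast, map_neg]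
  refine Finset.sum_congr rfl fun k hk => ?_
  have h := choose_two_mul_mul_pow_eq hn hi' (Nat.lt_succ_iff.1 (Finset.mem_range.1 hk))
  rw [neg_pow]
  generalize PadicInt.toZModPow 2 i = j at *
  rw [← pow_mul, show 3 * k = 2 * k + k by ring, pow_add j]
  linear_combination (k : ZMod (p ^ 2)) ^ 3 * ((2 * k).choose k : ZMod (p ^ 2)) ^ 2 * j ^ k * h

theorem coe_sum_eq {i : ℤ_[p]} (hi : 4 * i = 1) (n : ℕ) :
    (∑ k ∈ Finset.range (n + 1), (k : ℚ_[p]) ^ 3 * ((2 * k).choose k : ℚ_[p]) ^ 3 / 64 ^ k) =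
      ((∑ k ∈ Finset.range (n + 1),
        (k : ℤ_[p]) ^ 3 * ((2 * k).choose k : ℤ_[p]) ^ 3 * (i ^ 3) ^ k : ℤ_[p]) : ℚ_[p]) := by
  have hi' : (64 : ℚ_[p])⁻¹ = (i : ℚ_[p]) ^ 3 := by
    have h : (4 : ℚ_[p]) * i = 1 := by exact_mod_cast congrArg (Subtype.val) hi
    apply inv_eq_of_mul_eq_one_right
    linear_combination (16 * (i : ℚ_[p]) ^ 2 + 4 * i + 1) * h
  rw [PadicInt.coe_sum]
  refine Finset.sum_congr rfl fun k _ => ?_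
  push_cast
  rw [div_eq_mul_inv, ← inv_pow, hi']

end Congruences

/-! ### Assembly of the two residue classes. -/

theorem mainTheorem2 (p : ℕ) [Fact p.Prime] (hp : 5 < p) :
    (p % 4 = 1 →
      PadicModEq p (p ^ 2)
        (∑ k ∈ Finset.range ((p - 1) / 2 + 1),
          (k : ℚ_[p]) ^ 3 * ((2 * k).choose k : ℚ_[p]) ^ 3 / 64 ^ k)
        0) ∧
    (p % 4 = 3 →
      PadicModEq p (p ^ 2)
        (∑ k ∈ Finset.range ((p - 1) / 2 + 1),
          (k : ℚ_[p]) ^ 3 * ((2 * k).choose k : ℚ_[p]) ^ 3 / 64 ^ k)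
        (-(2 / (5 * (moritaGamma p (Ring.inverse 4) : ℚ_[p]) ^ 4)))) := by
  have hprime : p.Prime := Fact.out
  have hnd2 : ¬ p ∣ 2 := Nat.not_dvd_of_pos_of_lt (by norm_num) (by omega)
  have hnd5 : ¬ p ∣ 5 := Nat.not_dvd_of_pos_of_lt (by norm_num) hp
  have hnd4 : ¬ p ∣ 4 := Nat.not_dvd_of_pos_of_lt (by norm_num) (by omega)
  have hnd10 : ¬ p ∣ 10 := fun h =>
    (hprime.dvd_mul.1 (show p ∣ 2 * 5 from h)).elim hnd2 hnd5
  have hi : (4 : ℤ_[p]) * Ring.inverse 4 = 1 :=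
    Ring.mul_inverse_cancel _ (by exact_mod_cast isUnit_natCast_padicInt hnd4)
  have h10 : IsUnit (10 : ZMod (p ^ 2)) := by exact_mod_cast isUnit_natCast_zmod_sq hnd10
  generalize Ring.inverse (4 : ℤ_[p]) = i at *
  rw [coe_sum_eq hi]
  refine ⟨fun h1 => ?_, fun h3 => ?_⟩
  · obtain ⟨m, hm⟩ : ∃ m, p = 2 * (2 * m) + 1 := ⟨p / 4, by omega⟩
    rw [show (p - 1) / 2 = 2 * m by omega, ← PadicInt.coe_zero]
    apply padicModEq_of_toZModPow_eq
    have h := ten_mul_legendreSqMoment_three hm (by omega) hi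
    rw [legendreSqMoment_even hi, map_zero, neg_zero, map_mul, map_ofNat] at h
    rw [toZModPow_sum_eq_legendreSqMoment hm hi, map_zero]
    exact h10.mul_left_cancel (h.trans (mul_zero _).symm)
  · obtain ⟨m, hm⟩ : ∃ m, p = 4 * m + 3 := ⟨p / 4, by omega⟩
    have hm' : p = 2 * (2 * m + 1) + 1 := by omega
    have hc := legendre_coeff_sq_mul_moritaGamma hm hi
    have h := ten_mul_legendreSqMoment_three hm' (by omega) hi
    rw [legendreSqMoment_odd hi, map_mul (PadicInt.toZModPow 2) 10, map_ofNat] at h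
    rw [map_mul] at hc
    have h4 : IsUnit (4 : ZMod (p ^ 2)) := by exact_mod_cast isUnit_natCast_zmod_sq hnd4
    -- The congruence c² Γ_p(1/4)^4 ≡ 4 itself shows that Γ_p(1/4) is invertible.
    have hu : IsUnit (PadicInt.toZModPow 2 (moritaGamma p i ^ 4)) := by
      rw [← hc] at h4
      exact isUnit_of_mul_isUnit_right h4
    have hu5 : IsUnit (5 * moritaGamma p i ^ 4) := by
      refine IsUnit.mul ?_ (isUnit_of_isUnit_toZModPow_two hu)
      exact_mod_cast isUnit_natCast_padicInt hnd5
    obtain ⟨y, hy⟩ := isUnit_iff_exists_inv.1 hu5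
    -- With y the inverse of 5 Γ_p(1/4)^4, the p-adic quotient is the integer -2y, so it can be
    -- compared after reduction modulo p².
    have hyc : -(2 / (5 * (moritaGamma p i : ℚ_[p]) ^ 4)) = ((-(y + y) : ℤ_[p]) : ℚ_[p]) := by
      have h : 5 * (moritaGamma p i : ℚ_[p]) ^ 4 * (y : ℚ_[p]) = 1 := by
        exact_mod_cast congrArg (Subtype.val) hy
      have h0 := left_ne_zero_of_mul_eq_one h
      rw [div_eq_mul_inv, ← eq_inv_of_mul_eq_one_right h]
      push_cast
      ring
    rw [show (p - 1) / 2 = 2 * m + 1 by omega, hyc]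
    apply padicModEq_of_toZModPow_eq
    rw [toZModPow_sum_eq_legendreSqMoment hm' hi]
    apply (h10.mul hu).mul_left_cancel
    have hy' := congrArg (PadicInt.toZModPow 2) hy
    rw [map_mul, map_mul, map_ofNat, map_one] at hy'
    rw [map_neg, map_add]
    generalize PadicInt.toZModPow 2 (moritaGamma p i ^ 4) = g at *
    linear_combination g * h - hc + 4 * hy'
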